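/- **Setting.** Let $\mathcal U$ be a universe of input items. A maximization problem $B$ with accept/reject decisions specifies which finite sets $I\subset\mathcal U$ are consistent inputs (*instances*) and, for every instance $I$ and every set $A\subseteq I$ of accepted items, a real objective value $\mathrm{val}(I,A)$, or that this solution is infeasible ($\mathrm{val}(I,A)=-\infty$). $\mathrm{OPT}(I)=\max_{A\subseteq I}\mathrm{val}(I,A)$. The objective is *additive* if, for disjoint instances $I,J$ whose union is an instance, $\mathrm{OPT}(I\cup J)=\mathrm{OPT}(I)+\mathrm{OPT}(J)$ and $\mathrm{val}(I\cup J,A\cup C)\le \mathrm{val}(I,A)+\mathrm{val}(J,C)$ for all $A\subseteq I$, $C\subseteq J$. A *fixed priority algorithm with advice* has an injective priority function $P:\mathcal U\to\mathbb R$ chosen in advance. The items of the input $I$ are revealed in order of decreasing $P$. The algorithm irrevocably accepts or rejects each item when it is revealed, knowing the items revealed so far and bits of an infinite advice tape that an oracle prepared knowing $I$. It *reads at most $b$ bits* on $I$ if its decisions on $I$ do not depend on the tape beyond its first $b$ bits; it *reads fewer than $\beta(n)$ bits* if, for all sufficiently large $n$, it reads at most some number $b<\beta(n)$ of bits on every instance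 with $n$ items. It is a *$c$-approximation* ($c\ge 1$) if there is a constant $\alpha$ such that on all instances $I$ (having a feasible solution) its solution is feasible and its value $\mathrm{ALG}(I)$ satisfies $\mathrm{OPT}(I)\le c\,\mathrm{ALG}(I)+\alpha$. Its *(asymptotic) approximation ratio* is the infimum of these $c$ ($+\infty$ if there are none). For an instance $G$ with first item $u$ (the item of highest priority), $\mathrm{BAD}(G)$ is the best value attainable on $G$ after the wrong decision on $u$: if some optimal solution accepts $u$, the best value over solutions that reject $u$; otherwise the best value over solutions that accept $u$. **Theorem.** Let $B$ be a maximization problem with an additive objective function and let $P$ be a priority function. Suppose that for each $x\in\mathbb Q\cap[0,\tfrac12]$ there is a pair of instances (gadgets) $(G^1_x,G^2_x)$ such that: - (first item) $G_x^1$ and $G_x^2$ have the same first item $m_1(x)$ according to $P$; - (distinguishing decision) in each of $G^1_x$, $G^2_x$ all optimal solutions make the same decision on $m_1(x)$, and these optimal decisions are different for $G^1_x$ and $G^2_x$; - (size) the maximum $s=\max_x\max(|G^1_x|,|G^2_x|)$ exists and is finite; - (disjoint copies) for $x\neq y$ and $i,j\in\{1,2\}$, $G^i_x\cap G^j_y=\emptyset$,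 and the union of gadgets chosen for finitely many (at least one) different $x$, one for each such $x$, is an instance; - (OPT and BAD) $\mathrm{OPT}(G^1_x)$, $\mathrm{BAD}(G^1_x)$, $\mathrm{OPT}(G^2_x)$, $\mathrm{BAD}(G^2_x)$ are real numbers independent of $x$, denoted $\mathrm{OPT}(G^1)$, $\mathrm{BAD}(G^1)$, $\mathrm{OPT}(G^2)$, $\mathrm{BAD}(G^2)$, with $\mathrm{BAD}(G^1),\mathrm{BAD}(G^2)>0$ and $\mathrm{OPT}(G^2)\ge\mathrm{OPT}(G^1)$. Set $r=\min\left\{\frac{\mathrm{OPT}(G^1)}{\mathrm{BAD}(G^1)},\frac{\mathrm{OPT}(G^2)}{\mathrm{BAD}(G^2)}\right\}$ and let $H(p)=-p\log_2 p-(1-p)\log_2(1-p)$. Then for every $\epsilon\in(0,\tfrac12)$, no fixed priority algorithm with priority function $P$ that reads fewer than $(1-H(\epsilon))\,n/(2s)$ advice bits (on inputs of $n$ items) has an approximation ratio smaller than $$1+\frac{\epsilon\,(r-1)\,\mathrm{OPT}(G^1)}{\epsilon\,\mathrm{OPT}(G^1)+(1-\epsilon)\,r\,\mathrm{OPT}(G^2)}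 .$$ -/

import Mathlib

/-- A maximization problem with accept/reject decisions over a universe `U` of input items.
`IsInstance I` is the consistency condition on a finite set `I` of input items.  A solution of `I`
is given by the set `A ⊆ I` of accepted items (the items of `I \ A` are rejected), and
`value I A` is its objective value, where `⊥` means that the solution is not feasible. -/
structure MaxProblem (U : Type*) where
  IsInstance : Finset U → Prop
  value : Finset U → Finset U → WithBot ℝ

namespace MaxProblem

variable {U : Type*} [DecidableEq U] (B : MaxProblem U)

/-- The best value of the objective function on `I`. -/
noncomputable def opt (I : Finset U) : WithBot ℝ :=
  I.powerset.sup (B.value I)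

/-- `A` is an optimal (feasible) solution of `I`. -/
def IsOptimal (I A : Finset U) : Prop :=
  A ⊆ I ∧ B.value I A ≠ ⊥ ∧ ∀ C ⊆ I, B.value I C ≤ B.value I A

/-- The best value attainable on `I` when the decision on the item `u` is fixed to be `d`
(`true` is accept, `false` is reject). -/
noncomputable def bestGiven (I : Finset U) (u : U) (d : Bool) : WithBot ℝ :=
  (I.powerset.filter fun A => decide (u ∈ A) = d).sup (B.value I)

open Classical in
/-- The best value attainable on `I` after a wrong decision on the item `u`: if some optimal
solution accepts `u`, the best value given that `u` is rejected, and otherwise the best value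
given that `u` is accepted. -/
noncomputable def bad (I : Finset U) (u : U) : WithBot ℝ :=
  if ∃ A, B.IsOptimal I A ∧ u ∈ A then B.bestGiven I u false else B.bestGiven I u true

/-- `I` has an optimal solution, and `d` is the decision on `u` in every optimal solution. -/
def IsUniqueOptimalDecision (I : Finset U) (u : U) (d : Bool) : Prop :=
  (∃ A, B.IsOptimal I A) ∧ ∀ A, B.IsOptimal I A → decide (u ∈ A) = d

/-- The objective function is additive: on the union of two disjoint instances (when that union
is an instance) the optimal values add up, and no solution of the union is worth more than its
restrictions to the two parts are worth together. -/
structure IsAdditive : Prop where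
  opt_union : ∀ I J : Finset U, B.IsInstance I → B.IsInstance J → B.IsInstance (I ∪ J) →
    Disjoint I J → B.opt (I ∪ J) = B.opt I + B.opt J
  value_union_le : ∀ I J : Finset U, B.IsInstance I → B.IsInstance J → B.IsInstance (I ∪ J) →
    Disjoint I J → ∀ A ⊆ I, ∀ C ⊆ J,
      B.value (I ∪ J) (A ∪ C) ≤ B.value I A + B.value J C

end MaxProblem

/-- A (deterministic) fixed priority algorithm with advice.  The items of an input are revealed in
the order of decreasing priority.  `decision R u τ` is the decision on the current item `u` when
`R` is the set of the items revealed so far, `u` included (their order is known, since it is the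
order of the priorities), and `τ` is the advice tape.  `oracle I` is the infinite tape that the
oracle prepares for the input `I`. -/
structure FixedPriorityAlgorithm (U : Type*) where
  priority : U → ℝ
  priority_injective : Function.Injective priority
  decision : Finset U → U → (ℕ → Bool) → Bool
  oracle : Finset U → ℕ → Bool

namespace FixedPriorityAlgorithm

variable {U : Type*} [DecidableEq U] (ALG : FixedPriorityAlgorithm U)

/-- The items of `I` that have been revealed when `u` is the current item. -/
noncomputable def revealed (I : Finset U) (u : U) : Finset U :=
  I.filter fun v => ALG.priority u ≤ ALG.priority v

/-- The set of accepted items when the input is `I` and the tape is `τ`. -/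
noncomputable def run (I : Finset U) (τ : ℕ → Bool) : Finset U :=
  I.filter fun u => ALG.decision (ALG.revealed I u) u τ = true

/-- On the input `I`, with the tape prepared for it, the algorithm uses only the first `b` bits of
the tape: its decisions stay the same however the tape is continued after these bits. -/
def ReadsAtMost (I : Finset U) (b : ℕ) : Prop :=
  ∀ τ : ℕ → Bool, (∀ i < b, τ i = ALG.oracle I i) → ALG.run I τ = ALG.run I (ALG.oracle I)

/-- For all large `n`, the algorithm reads fewer than `β n` advice bits on every instance that
consists of `n` items. -/
def ReadsFewerThan (B : MaxProblem U) (β : ℕ → ℝ) : Prop :=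
  ∀ᶠ n : ℕ in Filter.atTop, ∀ I : Finset U, B.IsInstance I → I.card = n →
    ∃ b : ℕ, (b : ℝ) < β n ∧ ALG.ReadsAtMost I b

/-- The algorithm is a `c`-approximation (asymptotically, that is, up to an additive constant):
on every instance that has a feasible solution, it produces a feasible solution,
and `OPT(I) ≤ c * ALG(I) + α`. -/
def IsApproximation (B : MaxProblem U) (c : ℝ) : Prop :=
  1 ≤ c ∧ ∃ α : ℝ, ∀ I : Finset U, B.IsInstance I → ∀ w : ℝ, B.opt I = (w : WithBot ℝ) →
    ∃ v : ℝ, B.value I (ALG.run I (ALG.oracle I)) = (v : WithBot ℝ) ∧ w ≤ c * v + α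

/-- The (asymptotic) approximation ratio: the infimum of all `c` such that the algorithm is a
`c`-approximation (`⊤` if there is no such `c`). -/
noncomputable def approximationRatio (B : MaxProblem U) : EReal :=
  sInf ((fun c : ℝ => (c : EReal)) '' {c : ℝ | ALG.IsApproximation B c})

end FixedPriorityAlgorithm

/-- The binary entropy function, with logarithms to the base `2`. -/
noncomputable def entropyTwo (p : ℝ) : ℝ :=
  -p * Real.logb 2 p - (1 - p) * Real.logb 2 (1 - p)

/-- `u` is the first item (the one of highest priority) of `G`. -/
def IsFirstItem {U : Type*} (P : U → ℝ) (G : Finset U) (u : U) : Prop :=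
  u ∈ G ∧ ∀ v ∈ G, P v ≤ P u

/-- The conditions on the gadget pairs `(G₁ x, G₂ x)`, `x ∈ ℚ ∩ [0, 1/2]`, with first items `m x`,
for the problem `B` and the priority function `P`; `o₁`, `b₁`, `o₂`, `b₂` are the common values
of OPT and BAD, and `s` is the maximum size of a gadget. -/
structure IsGadgetFamily {U : Type*} [DecidableEq U] (B : MaxProblem U) (P : U → ℝ)
    (G₁ G₂ : Set.Icc (0 : ℚ) (1 / 2) → Finset U) (m : Set.Icc (0 : ℚ) (1 / 2) → U)
    (o₁ b₁ o₂ b₂ : ℝ) (s : ℕ) : Prop where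
  isInstance₁ : ∀ x, B.IsInstance (G₁ x)
  isInstance₂ : ∀ x, B.IsInstance (G₂ x)
  firstItem₁ : ∀ x, IsFirstItem P (G₁ x) (m x)
  firstItem₂ : ∀ x, IsFirstItem P (G₂ x) (m x)
  distinguishing : ∀ x, ∃ d : Bool,
    B.IsUniqueOptimalDecision (G₁ x) (m x) d ∧ B.IsUniqueOptimalDecision (G₂ x) (m x) (!d)
  size : IsGreatest (Set.range (fun x => (G₁ x).card) ∪ Set.range (fun x => (G₂ x).card)) s
  disjoint : ∀ x y, x ≠ y →
    Disjoint (G₁ x) (G₁ y) ∧ Disjoint (G₁ x) (G₂ y) ∧ Disjoint (G₂ x) (G₂ y)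
  /-- Taking one gadget for each of finitely many `x` gives a consistent input. -/
  isInstance_union : ∀ S T : Finset (Set.Icc (0 : ℚ) (1 / 2)), Disjoint S T → (S ∪ T).Nonempty →
    B.IsInstance (S.biUnion G₁ ∪ T.biUnion G₂)
  opt₁ : ∀ x, B.opt (G₁ x) = (o₁ : WithBot ℝ)
  bad₁ : ∀ x, B.bad (G₁ x) (m x) = (b₁ : WithBot ℝ)
  opt₂ : ∀ x, B.opt (G₂ x) = (o₂ : WithBot ℝ)
  bad₂ : ∀ x, B.bad (G₂ x) (m x) = (b₂ : WithBot ℝ)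
  opt_le : o₁ ≤ o₂

/-! An adversary fixes a large finite set `S` of points and, for each `T ⊆ S`, builds an input with
the second gadget at the points of `T` and the first gadget elsewhere. The two gadgets at a point
share their first item and demand opposite decisions on it, so each point poses a binary question
that is answered before the gadget shows which one it is.

For a fixed tape, the set of wrongly answered points determines `T` (`errorSet_run_injOn`). Hence
`k` advice bits and error sets of size below `ε * #S` can serve at most `2 ^ (k + entropyTwo ε *
#S)` choices of `T`, by the volume of a Hamming ball. When `k < (1 - entropyTwo ε) * #S`, this is
less than `2 ^ #S`, so some `T` forces errors at a fraction `ε` of the points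
(`exists_le_card_errorSet`).

By additivity each error reduces the bound on a gadget's contribution from OPT to BAD, a factor of
at least `r`. For `c` below the claimed ratio, OPT minus `c` times ALG then grows linearly in `#S`,
beyond any additive constant. -/

open Finset

/-! ### Optimal values, bad values and additivity -/

namespace MaxProblem

theorem value_le_opt {U : Type*} {B : MaxProblem U} {I A : Finset U} (hA : A ⊆ I) : B.value I A ≤ B.opt I :=
  Finset.le_sup (f := B.value I) (mem_powerset.2 hA)

variable {U : Type*} [DecidableEq U] {B : MaxProblem U}

theorem value_le_bestGiven {I A : Finset U} (hA : A ⊆ I) {u : U} {d : Bool}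
    (hu : decide (u ∈ A) = d) : B.value I A ≤ B.bestGiven I u d :=
  Finset.le_sup (f := B.value I) (mem_filter.2 ⟨mem_powerset.2 hA, hu⟩)

theorem IsUniqueOptimalDecision.bad_eq {I : Finset U} {u : U} {d : Bool}
    (h : B.IsUniqueOptimalDecision I u d) : B.bad I u = B.bestGiven I u (!d) := by
  obtain ⟨⟨A, hA⟩, hd⟩ := h
  unfold bad
  split_ifs with hex
  · obtain ⟨C, hC, hu⟩ := hex
    have := hd C hC
    simp only [hu, decide_true] at this
    simp [← this]
  · have := hd A hA
    have hu : u ∉ A := fun hu => hex ⟨A, hA, hu⟩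
    simp only [hu, decide_false] at this
    simp [← this]

/-- A best solution with the wrong decision, if it reached OPT, would itself be optimal. This is
what gives `r > 1`. -/
theorem IsUniqueOptimalDecision.bad_lt_opt {I : Finset U} {u : U} {d : Bool}
    (h : B.IsUniqueOptimalDecision I u d) (hbad : B.bad I u ≠ ⊥) : B.bad I u < B.opt I := by
  by_contra! hle
  rw [h.bad_eq] at hle hbad
  have hne : (I.powerset.filter fun A => decide (u ∈ A) = !d).Nonempty := by
    by_contra hemp
    rw [not_nonempty_iff_eq_empty] at hemp
    exact hbad (by simp [bestGiven, hemp])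
  obtain ⟨A, hA, hval⟩ := Finset.exists_mem_eq_sup _ hne (B.value I)
  change B.bestGiven I u (!d) = _ at hval
  rw [mem_filter, mem_powerset] at hA
  rw [hval] at hle hbad
  have := h.2 A ⟨hA.1, hbad, fun C hC => (value_le_opt hC).trans hle⟩
  rw [hA.2] at this
  simp at this

theorem disjoint_biUnion_of_pairwise {ι : Type*} {g : ι → Finset U}
    (hdisj : Pairwise fun x y => Disjoint (g x) (g y))
    {a : ι} {S : Finset ι} (ha : a ∉ S) : Disjoint (g a) (S.biUnion g) := by
  rw [disjoint_biUnion_right]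
  exact fun y hy => hdisj (fun h => ha (h ▸ hy))

variable {ι : Type*} [DecidableEq ι] {g : ι → Finset U}

theorem IsAdditive.opt_biUnion (hB : B.IsAdditive)
    (hinst : ∀ S : Finset ι, S.Nonempty → B.IsInstance (S.biUnion g))
    (hdisj : Pairwise fun x y => Disjoint (g x) (g y)) {o : ι → ℝ}
    (ho : ∀ x, B.opt (g x) = (o x : WithBot ℝ)) {S : Finset ι} (hS : S.Nonempty) :
    B.opt (S.biUnion g) = ((∑ x ∈ S, o x : ℝ) : WithBot ℝ) := by
  induction hS using Finset.Nonempty.cons_induction with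
  -- The induction starts at singletons because the empty set need not be an instance.
  | singleton a => simp [ho]
  | cons a S ha hS ih =>
    have h₁ := hinst {a} (singleton_nonempty a)
    have h₂ := hinst (insert a S) (insert_nonempty a S)
    rw [singleton_biUnion] at h₁
    rw [biUnion_insert] at h₂
    rw [cons_eq_insert, biUnion_insert, sum_insert ha, hB.opt_union _ _ h₁ (hinst S hS) h₂
      (disjoint_biUnion_of_pairwise hdisj ha), ho, ih, WithBot.coe_add]

theorem IsAdditive.value_biUnion_le (hB : B.IsAdditive)
    (hinst : ∀ S : Finset ι, S.Nonempty → B.IsInstance (S.biUnion g))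
    (hdisj : Pairwise fun x y => Disjoint (g x) (g y)) {a : ι → Finset U}
    (hag : ∀ x, a x ⊆ g x) {v : ι → ℝ} {S : Finset ι} (hS : S.Nonempty)
    (hv : ∀ x ∈ S, B.value (g x) (a x) ≤ (v x : WithBot ℝ)) :
    B.value (S.biUnion g) (S.biUnion a) ≤ ((∑ x ∈ S, v x : ℝ) : WithBot ℝ) := by
  induction hS using Finset.Nonempty.cons_induction with
  | singleton x => simpa using hv
  | cons x S hx hS ih =>
    have h₁ := hinst {x} (singleton_nonempty x)
    have h₂ := hinst (insert x S) (insert_nonempty x S)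
    rw [singleton_biUnion] at h₁
    rw [biUnion_insert] at h₂
    rw [cons_eq_insert, biUnion_insert, biUnion_insert, sum_insert hx, WithBot.coe_add]
    refine (hB.value_union_le _ _ h₁ (hinst S hS) h₂ (disjoint_biUnion_of_pairwise hdisj hx)
      _ (hag x) _ (biUnion_mono fun y _ => hag y)).trans ?_
    exact add_le_add (hv x (mem_cons_self x S)) (ih fun y hy => hv y (mem_cons_of_mem hy))

end MaxProblem

/-! ### Advice bits, Hamming balls and choices of gadgets -/

theorem FixedPriorityAlgorithm.ReadsAtMost.mono {U : Type*} [DecidableEq U]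
    {ALG : FixedPriorityAlgorithm U} {I : Finset U} {b k : ℕ} (h : ALG.ReadsAtMost I b)
    (hbk : b ≤ k) : ALG.ReadsAtMost I k :=
  fun τ hτ => h τ fun i hi => hτ i (hi.trans_le hbk)

/-- Volume bound for Hamming balls. -/
theorem card_powerset_filter_card_le {ι : Type*} (S : Finset ι) {ε : ℝ}
    (hε : ε ∈ Set.Ioo (0 : ℝ) (1 / 2)) :
    ((S.powerset.filter fun E => (#E : ℝ) ≤ ε * #S).card : ℝ) ≤ 2 ^ (entropyTwo ε * #S) := by
  obtain ⟨h0, h1⟩ := hε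
  have hq : 0 < 1 - ε := by linarith
  have hlog : Real.logb 2 ε ≤ Real.logb 2 (1 - ε) :=
    Real.logb_le_logb_of_le (by norm_num) h0 (by linarith)
  -- Weigh `E` by its probability when each point is taken independently with probability `ε`. As `ε
  -- ≤ 1 - ε`, the weight decreases in `#E`, and at `#E = ε * #S` it would be the left side. The
  -- weights of all subsets sum to 1.
  have hterm : ∀ E ∈ S.powerset.filter fun E => (#E : ℝ) ≤ ε * #S,
      (2 : ℝ) ^ (-(entropyTwo ε * #S)) ≤ ε ^ #E * (1 - ε) ^ (#S - #E) := by
    intro E hE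
    rw [mem_filter, mem_powerset] at hE
    have hcard := card_le_card hE.1
    have hεlog : ε = (2 : ℝ) ^ Real.logb 2 ε :=
      (Real.rpow_logb (by norm_num) (by norm_num) h0).symm
    have hqlog : 1 - ε = (2 : ℝ) ^ Real.logb 2 (1 - ε) :=
      (Real.rpow_logb (by norm_num) (by norm_num) hq).symm
    have heq : ε ^ #E * (1 - ε) ^ (#S - #E) =
        (2 : ℝ) ^ (Real.logb 2 ε * #E + Real.logb 2 (1 - ε) * ((#S : ℝ) - #E)) := by
      rw [Real.rpow_add (by norm_num), Real.rpow_mul (by norm_num), Real.rpow_mul (by norm_num),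
        ← hεlog, ← hqlog, ← Nat.cast_sub hcard, Real.rpow_natCast, Real.rpow_natCast]
    rw [heq]
    apply Real.rpow_le_rpow_of_exponent_le (by norm_num)
    unfold entropyTwo
    nlinarith [mul_nonneg (sub_nonneg.2 hlog) (sub_nonneg.2 hE.2)]
  have hsum := Finset.sum_pow_mul_eq_add_pow ε (1 - ε) S
  have hle : ∑ E ∈ S.powerset.filter (fun E => (#E : ℝ) ≤ ε * #S),
      ε ^ #E * (1 - ε) ^ (#S - #E) ≤ 1 := by
    calc _ ≤ ∑ E ∈ S.powerset, ε ^ #E * (1 - ε) ^ (#S - #E) :=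
          sum_le_sum_of_subset_of_nonneg (filter_subset _ _) fun _ _ _ => by positivity
      _ = 1 := by rw [hsum]; simp
  have := (Finset.card_nsmul_le_sum _ _ _ hterm).trans hle
  rw [nsmul_eq_mul, Real.rpow_neg (by norm_num), ← div_eq_mul_inv,
    div_le_one (by positivity)] at this
  exact this

/-- The gadget chosen at `x` when the second gadget is taken exactly at the points of `T`. -/
def gadgetChoice {U ι : Type*} [DecidableEq ι] (G₁ G₂ : ι → Finset U) (T : Finset ι) (x : ι) :
    Finset U :=
  if x ∈ T then G₂ x else G₁ x

theorem biUnion_gadgetChoice {U ι : Type*} [DecidableEq U] [DecidableEq ι]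
    (G₁ G₂ : ι → Finset U) (S T : Finset ι) :
    S.biUnion (gadgetChoice G₁ G₂ T) = (S \ T).biUnion G₁ ∪ (S ∩ T).biUnion G₂ := by
  ext u
  simp only [gadgetChoice, mem_biUnion, mem_union, mem_sdiff, mem_inter]
  constructor
  · rintro ⟨x, hx, hu⟩
    split_ifs at hu with h
    · exact Or.inr ⟨x, ⟨hx, h⟩, hu⟩
    · exact Or.inl ⟨x, ⟨hx, h⟩, hu⟩
  · rintro (⟨x, ⟨hx, h⟩, hu⟩ | ⟨x, ⟨hx, h⟩, hu⟩)
    · exact ⟨x, hx, by simpa [h] using hu⟩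
    · exact ⟨x, hx, by simpa [h] using hu⟩

/-! ### Error sets and the counting argument -/

section ErrorSet

variable {U ι : Type*} [DecidableEq U] [DecidableEq ι]

/-- The points of `S` at which the decisions in `A` on the items `m x` are wrong, where the right
decision is `!d x` if `x ∈ T` and `d x` otherwise. -/
def errorSet (m : ι → U) (d : ι → Bool) (S T : Finset ι) (A : Finset U) : Finset ι :=
  S.filter fun x => decide (m x ∈ A) ≠ if x ∈ T then !d x else d x

theorem errorSet_subset (m : ι → U) (d : ι → Bool) (S T : Finset ι) (A : Finset U) :
    errorSet m d S T A ⊆ S :=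
  filter_subset _ _

/-- With a fixed tape, the choice of the gadgets can be recovered from the errors that the
algorithm makes: when `m x` is revealed, only the choices at points of higher priority are
visible. -/
theorem errorSet_run_injOn (ALG : FixedPriorityAlgorithm U) {G₁ G₂ : ι → Finset U} {m : ι → U}
    (h₁ : ∀ x, IsFirstItem ALG.priority (G₁ x) (m x))
    (h₂ : ∀ x, IsFirstItem ALG.priority (G₂ x) (m x))
    (d : ι → Bool) (S : Finset ι) (τ : ℕ → Bool) :
    Set.InjOn (fun T => errorSet m d S T (ALG.run (S.biUnion (gadgetChoice G₁ G₂ T)) τ))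
      (S.powerset : Set (Finset ι)) := by
  have hfirst : ∀ T x, IsFirstItem ALG.priority (gadgetChoice G₁ G₂ T x) (m x) := by
    intro T x
    unfold gadgetChoice
    split_ifs
    exacts [h₂ x, h₁ x]
  intro T hT T' hT' heq
  rw [mem_coe, mem_powerset] at hT hT'
  by_contra hne
  have hsd : (symmDiff T T').Nonempty := by
    rw [nonempty_iff_ne_empty]
    intro h
    exact hne (symmDiff_eq_bot.1 h)
  -- The disagreement of `T` and `T'` that is met first; up to `m x` the two inputs look the same.
  obtain ⟨x, hx, hmax⟩ := exists_max_image _ (fun y => ALG.priority (m y)) hsd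
  have hxS : x ∈ S := by
    rcases mem_symmDiff.1 hx with h | h
    exacts [hT h.1, hT' h.1]
  have hsub : ∀ T₁ T₂ : Finset ι, symmDiff T₁ T₂ = symmDiff T T' →
      ALG.revealed (S.biUnion (gadgetChoice G₁ G₂ T₁)) (m x) ⊆
        ALG.revealed (S.biUnion (gadgetChoice G₁ G₂ T₂)) (m x) := by
    intro T₁ T₂ hsymm v hv
    simp only [FixedPriorityAlgorithm.revealed, mem_filter, mem_biUnion] at hv ⊢
    obtain ⟨⟨y, hy, hvy⟩, hpv⟩ := hv
    refine ⟨⟨y, hy, ?_⟩, hpv⟩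
    have hvm := (hfirst T₁ y).2 v hvy
    -- A gadget at a point of disagreement can show at most its first item by then, and both choices
    -- contain that item.
    by_cases hmem : y ∈ symmDiff T T'
    · have hle := hmax y hmem
      have hv_eq : v = m y := ALG.priority_injective (le_antisymm hvm (hle.trans hpv))
      rw [hv_eq]
      exact (hfirst T₂ y).1
    · rw [← hsymm, mem_symmDiff] at hmem
      have hiff : y ∈ T₁ ↔ y ∈ T₂ := by tauto
      simpa [gadgetChoice, hiff] using hvy
  have hrev := (hsub T T' rfl).antisymm (hsub T' T (symmDiff_comm _ _))
  have hmem : ∀ T, m x ∈ S.biUnion (gadgetChoice G₁ G₂ T) := fun T =>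
    mem_biUnion.2 ⟨x, hxS, (hfirst T x).1⟩
  have hrun : m x ∈ ALG.run (S.biUnion (gadgetChoice G₁ G₂ T)) τ ↔
      m x ∈ ALG.run (S.biUnion (gadgetChoice G₁ G₂ T')) τ := by
    simp only [FixedPriorityAlgorithm.run, mem_filter, hmem, true_and, hrev]
  have hiff : x ∈ errorSet m d S T (ALG.run (S.biUnion (gadgetChoice G₁ G₂ T)) τ) ↔
      x ∈ errorSet m d S T' (ALG.run (S.biUnion (gadgetChoice G₁ G₂ T')) τ) := by
    rw [show errorSet m d S T _ = errorSet m d S T' _ from heq]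
  simp only [errorSet, mem_filter, hxS, true_and, hrun] at hiff
  -- The decision on `m x` is the same in both runs but the right decisions are opposite, so exactly
  -- one run errs at `x`.
  rcases mem_symmDiff.1 hx with h | h <;> simp only [h.1, h.2, if_true, if_false] at hiff <;>
    generalize decide (m x ∈ ALG.run (S.biUnion (gadgetChoice G₁ G₂ T')) τ) = e at hiff <;>
    cases e <;> cases hd : d x <;> simp [hd] at hiff

/-- With few advice bits, some choice of the gadgets forces many errors. -/
theorem exists_le_card_errorSet (ALG : FixedPriorityAlgorithm U) {G₁ G₂ : ι → Finset U}
    {m : ι → U} (h₁ : ∀ x, IsFirstItem ALG.priority (G₁ x) (m x))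
    (h₂ : ∀ x, IsFirstItem ALG.priority (G₂ x) (m x))
    (d : ι → Bool) (S : Finset ι) {ε : ℝ} (hε : ε ∈ Set.Ioo (0 : ℝ) (1 / 2)) {k : ℕ}
    (hk : (k : ℝ) < (1 - entropyTwo ε) * #S)
    (hreads : ∀ T ⊆ S, ALG.ReadsAtMost (S.biUnion (gadgetChoice G₁ G₂ T)) k) :
    ∃ T ⊆ S, ε * #S ≤ #(errorSet m d S T (ALG.run (S.biUnion (gadgetChoice G₁ G₂ T))
      (ALG.oracle (S.biUnion (gadgetChoice G₁ G₂ T))))) := by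
  by_contra! hlt
  let I := fun T => S.biUnion (gadgetChoice G₁ G₂ T)
  let bits : Finset ι → Fin k → Bool := fun T i => ALG.oracle (I T) i
  -- The padding with `false` is harmless: the bits from `k` on do not affect the run.
  let tape : (Fin k → Bool) → ℕ → Bool := fun f i => if h : i < k then f ⟨i, h⟩ else false
  have htape : ∀ T ⊆ S, ALG.run (I T) (ALG.oracle (I T)) = ALG.run (I T) (tape (bits T)) :=
    fun T hT => (hreads T hT _ fun i hi => by simp [tape, hi, bits, I]).symm
  have hcard : #S.powerset ≤ #((univ : Finset (Fin k → Bool)) ×ˢ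
      S.powerset.filter fun E => (#E : ℝ) ≤ ε * #S) := by
    refine card_le_card_of_injOn
      (fun T => (bits T, errorSet m d S T (ALG.run (I T) (ALG.oracle (I T))))) ?_ ?_
    · intro T hT
      rw [mem_coe, mem_powerset] at hT
      rw [mem_coe, mem_product, mem_filter, mem_powerset]
      exact ⟨mem_univ _, errorSet_subset _ _ _ _ _, (hlt T hT).le⟩
    · intro T hT T' hT' heq
      rw [Prod.mk.injEq] at heq
      obtain ⟨hbits, herr⟩ := heq
      rw [htape T (mem_powerset.1 hT), htape T' (mem_powerset.1 hT'), ← hbits] at herr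
      exact errorSet_run_injOn ALG h₁ h₂ d S _ hT hT' herr
  rw [card_product, card_powerset, card_univ, Fintype.card_fun, Fintype.card_bool,
    Fintype.card_fin] at hcard
  have hball := card_powerset_filter_card_le S hε
  have hpow : (2 : ℝ) ^ (#S : ℝ) ≤ 2 ^ (k : ℝ) * 2 ^ (entropyTwo ε * #S) := by
    rw [Real.rpow_natCast, Real.rpow_natCast]
    refine le_trans ?_ (mul_le_mul_of_nonneg_left hball (by positivity))
    exact_mod_cast hcard
  rw [← Real.rpow_add (by norm_num), Real.rpow_le_rpow_left_iff (by norm_num)] at hpow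
  linarith

end ErrorSet

/-! ### Inputs made of gadgets -/

namespace IsGadgetFamily

variable {U : Type*} [DecidableEq U] {B : MaxProblem U} {P : U → ℝ}
  {G₁ G₂ : Set.Icc (0 : ℚ) (1 / 2) → Finset U} {m : Set.Icc (0 : ℚ) (1 / 2) → U}
  {o₁ b₁ o₂ b₂ : ℝ} {s : ℕ}

theorem firstItem_gadgetChoice (hG : IsGadgetFamily B P G₁ G₂ m o₁ b₁ o₂ b₂ s)
    (T : Finset (Set.Icc (0 : ℚ) (1 / 2))) (x : Set.Icc (0 : ℚ) (1 / 2)) :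
    IsFirstItem P (gadgetChoice G₁ G₂ T x) (m x) := by
  unfold gadgetChoice
  split_ifs
  exacts [hG.firstItem₂ x, hG.firstItem₁ x]

theorem pairwise_disjoint_gadgetChoice (hG : IsGadgetFamily B P G₁ G₂ m o₁ b₁ o₂ b₂ s)
    (T : Finset (Set.Icc (0 : ℚ) (1 / 2))) :
    Pairwise fun x y => Disjoint (gadgetChoice G₁ G₂ T x) (gadgetChoice G₁ G₂ T y) := by
  intro x y hxy
  unfold gadgetChoice
  have h := hG.disjoint x y hxy
  have h' := hG.disjoint y x hxy.symm
  split_ifs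
  exacts [h.2.2, h'.2.1.symm, h.2.1, h.1]

theorem isInstance_biUnion_gadgetChoice (hG : IsGadgetFamily B P G₁ G₂ m o₁ b₁ o₂ b₂ s)
    (T : Finset (Set.Icc (0 : ℚ) (1 / 2))) {S : Finset (Set.Icc (0 : ℚ) (1 / 2))}
    (hS : S.Nonempty) : B.IsInstance (S.biUnion (gadgetChoice G₁ G₂ T)) := by
  rw [biUnion_gadgetChoice]
  exact hG.isInstance_union _ _ (disjoint_sdiff_inter S T) (by rwa [sdiff_union_inter])

theorem bad_lt_opt (hG : IsGadgetFamily B P G₁ G₂ m o₁ b₁ o₂ b₂ s) : b₁ < o₁ ∧ b₂ < o₂ := by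
  let x : Set.Icc (0 : ℚ) (1 / 2) := ⟨0, by norm_num⟩
  obtain ⟨d, hd₁, hd₂⟩ := hG.distinguishing x
  have h₁ := hd₁.bad_lt_opt (by simp [hG.bad₁])
  have h₂ := hd₂.bad_lt_opt (by simp [hG.bad₂])
  rw [hG.bad₁, hG.opt₁, WithBot.coe_lt_coe] at h₁
  rw [hG.bad₂, hG.opt₂, WithBot.coe_lt_coe] at h₂
  exact ⟨h₁, h₂⟩

theorem card_gadgetChoice_mem_Icc (hG : IsGadgetFamily B P G₁ G₂ m o₁ b₁ o₂ b₂ s)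
    (T : Finset (Set.Icc (0 : ℚ) (1 / 2))) (x : Set.Icc (0 : ℚ) (1 / 2)) :
    #(gadgetChoice G₁ G₂ T x) ∈ Set.Icc 1 s := by
  unfold gadgetChoice
  split_ifs
  · exact ⟨card_pos.2 ⟨_, (hG.firstItem₂ x).1⟩, hG.size.2 (Or.inr ⟨x, rfl⟩)⟩
  · exact ⟨card_pos.2 ⟨_, (hG.firstItem₁ x).1⟩, hG.size.2 (Or.inl ⟨x, rfl⟩)⟩

theorem card_biUnion_gadgetChoice_mem_Icc (hG : IsGadgetFamily B P G₁ G₂ m o₁ b₁ o₂ b₂ s)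
    (S T : Finset (Set.Icc (0 : ℚ) (1 / 2))) :
    #(S.biUnion (gadgetChoice G₁ G₂ T)) ∈ Set.Icc #S (#S * s) := by
  rw [card_biUnion fun x _ y _ hxy => hG.pairwise_disjoint_gadgetChoice T hxy]
  constructor
  · simpa using card_nsmul_le_sum S _ 1 fun x _ => (hG.card_gadgetChoice_mem_Icc T x).1
  · simpa using sum_le_card_nsmul S _ s fun x _ => (hG.card_gadgetChoice_mem_Icc T x).2

theorem opt_gadgetChoice (hG : IsGadgetFamily B P G₁ G₂ m o₁ b₁ o₂ b₂ s)
    (T : Finset (Set.Icc (0 : ℚ) (1 / 2))) (x : Set.Icc (0 : ℚ) (1 / 2)) :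
    B.opt (gadgetChoice G₁ G₂ T x) = ((if x ∈ T then o₂ else o₁ : ℝ) : WithBot ℝ) := by
  unfold gadgetChoice
  split_ifs
  exacts [hG.opt₂ x, hG.opt₁ x]

theorem value_le_of_wrong_decision (hG : IsGadgetFamily B P G₁ G₂ m o₁ b₁ o₂ b₂ s)
    (T : Finset (Set.Icc (0 : ℚ) (1 / 2))) {x : Set.Icc (0 : ℚ) (1 / 2)} {d : Bool}
    (hd₁ : B.IsUniqueOptimalDecision (G₁ x) (m x) d)
    (hd₂ : B.IsUniqueOptimalDecision (G₂ x) (m x) (!d)) {A : Finset U}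
    (hA : A ⊆ gadgetChoice G₁ G₂ T x)
    (hwrong : decide (m x ∈ A) ≠ if x ∈ T then !d else d) :
    B.value (gadgetChoice G₁ G₂ T x) A ≤ ((if x ∈ T then b₂ else b₁ : ℝ) : WithBot ℝ) := by
  unfold gadgetChoice at hA ⊢
  split_ifs at hA hwrong ⊢
  · rw [← hG.bad₂ x, hd₂.bad_eq]
    exact MaxProblem.value_le_bestGiven hA (Bool.eq_not_of_ne hwrong)
  · rw [← hG.bad₁ x, hd₁.bad_eq]
    exact MaxProblem.value_le_bestGiven hA (Bool.eq_not_of_ne hwrong)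

/-- The value of a solution of a union of gadgets in terms of its wrong decisions. -/
theorem value_biUnion_gadgetChoice_le (hG : IsGadgetFamily B P G₁ G₂ m o₁ b₁ o₂ b₂ s)
    (hB : B.IsAdditive) {d : Set.Icc (0 : ℚ) (1 / 2) → Bool}
    (hd : ∀ x, B.IsUniqueOptimalDecision (G₁ x) (m x) (d x) ∧
      B.IsUniqueOptimalDecision (G₂ x) (m x) (!d x))
    {S : Finset (Set.Icc (0 : ℚ) (1 / 2))} (hS : S.Nonempty)
    (T : Finset (Set.Icc (0 : ℚ) (1 / 2))) {A : Finset U}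
    (hA : A ⊆ S.biUnion (gadgetChoice G₁ G₂ T)) :
    B.value (S.biUnion (gadgetChoice G₁ G₂ T)) A ≤
      ((∑ x ∈ S, if x ∈ errorSet m d S T A then (if x ∈ T then b₂ else b₁)
        else (if x ∈ T then o₂ else o₁) : ℝ) : WithBot ℝ) := by
  have hAeq : A = S.biUnion fun x => A ∩ gadgetChoice G₁ G₂ T x := by
    rw [← inter_biUnion, inter_eq_left.2 hA]
  have key := hB.value_biUnion_le (a := fun x => A ∩ gadgetChoice G₁ G₂ T x)
    (v := fun x => if x ∈ errorSet m d S T A then (if x ∈ T then b₂ else b₁)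
        else (if x ∈ T then o₂ else o₁))
    (fun _ h => hG.isInstance_biUnion_gadgetChoice T h)
    (hG.pairwise_disjoint_gadgetChoice T) (fun x => inter_subset_right) hS ?_
  · rwa [← hAeq] at key
  · intro x _
    by_cases hx : x ∈ errorSet m d S T A
    · simp only [hx, if_true]
      refine hG.value_le_of_wrong_decision T (hd x).1 (hd x).2 inter_subset_right ?_
      simpa [(hG.firstItem_gadgetChoice T x).1] using (mem_filter.1 hx).2
    · simp only [hx, if_false]
      exact (MaxProblem.value_le_opt inter_subset_right).trans_eq (hG.opt_gadgetChoice T x)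

/-- Some choice of the gadgets at the points of `S` makes the algorithm err at least at a
fraction `ε` of the points. -/
theorem exists_many_errors (hG : IsGadgetFamily B P G₁ G₂ m o₁ b₁ o₂ b₂ s)
    {ε : ℝ} (hε : ε ∈ Set.Ioo (0 : ℝ) (1 / 2)) {ALG : FixedPriorityAlgorithm U}
    (hP : ALG.priority = P) (d : Set.Icc (0 : ℚ) (1 / 2) → Bool)
    {S : Finset (Set.Icc (0 : ℚ) (1 / 2))} (hS : S.Nonempty)
    (hadvice : ∀ n ≥ #S, ∀ I : Finset U, B.IsInstance I → #I = n →
      ∃ b : ℕ, (b : ℝ) < (1 - entropyTwo ε) * n / (2 * s) ∧ ALG.ReadsAtMost I b) :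
    ∃ T ⊆ S, ε * #S ≤ #(errorSet m d S T (ALG.run (S.biUnion (gadgetChoice G₁ G₂ T))
      (ALG.oracle (S.biUnion (gadgetChoice G₁ G₂ T))))) := by
  subst hP
  have hSpos : (0 : ℝ) < #S := by exact_mod_cast card_pos.2 hS
  -- The input size varies with `T`; since it is at most `#S * s`, the advice bound becomes uniform
  -- in `T`.
  have hbits : ∀ T, ∃ b : ℕ, (b : ℝ) < (1 - entropyTwo ε) * #S / 2 ∧
      ALG.ReadsAtMost (S.biUnion (gadgetChoice G₁ G₂ T)) b := by
    intro T
    obtain ⟨hle, hge⟩ := hG.card_biUnion_gadgetChoice_mem_Icc S T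
    obtain ⟨b, hb, hread⟩ := hadvice _ hle _ (hG.isInstance_biUnion_gadgetChoice T hS) rfl
    refine ⟨b, hb.trans_le ?_, hread⟩
    set N := #(S.biUnion (gadgetChoice G₁ G₂ T))
    have hN : (0 : ℝ) < N := hSpos.trans_le (by exact_mod_cast hle)
    have hNs : (N : ℝ) ≤ #S * s := by exact_mod_cast hge
    have hs : (0 : ℝ) < s := by
      by_contra! h
      nlinarith
    have hpos : 0 < (1 - entropyTwo ε) * N / (2 * s) := (Nat.cast_nonneg b).trans_lt hb
    -- No analysis of the entropy is needed: a natural number lies strictly below the advice bound.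
    have hH : 0 < 1 - entropyTwo ε := by
      by_contra! h
      exact hpos.not_ge
        (div_nonpos_of_nonpos_of_nonneg (mul_nonpos_of_nonpos_of_nonneg h hN.le) (by positivity))
    rw [div_le_div_iff₀ (by positivity) (by norm_num)]
    nlinarith [mul_le_mul_of_nonneg_left hNs hH.le]
  have hz : 0 < (1 - entropyTwo ε) * #S / 2 := by
    obtain ⟨b, hb, -⟩ := hbits ∅
    exact (Nat.cast_nonneg b).trans_lt hb
  -- The spare factor 1/2 in the advice bound makes the inequality for `k` strict.
  refine exists_le_card_errorSet ALG hG.firstItem₁ hG.firstItem₂ d S hε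
    (k := ⌊(1 - entropyTwo ε) * #S / 2⌋₊) ?_ fun T _ => ?_
  · have := Nat.floor_le hz.le
    linarith
  · obtain ⟨b, hb, hread⟩ := hbits T
    exact hread.mono (Nat.le_floor hb.le)

end IsGadgetFamily

/-! ### Loss from errors and the final estimate -/

/-- If at least a fraction `ε` of the terms of a sum `∑ o x` is replaced by the smaller `b x`, the
sum decreases substantially. -/
theorem mul_card_le_sum_sub_mul_sum {ι : Type*} [DecidableEq ι] {S E : Finset ι} (hE : E ⊆ S)
    {o b : ι → ℝ} {o₁ o₂ r c ε : ℝ} (ho₁ : 0 ≤ o₁) (hoo : o₁ ≤ o₂)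
    (ho : ∀ x, o x ∈ Set.Icc o₁ o₂) (hr : 0 < r) (hb : ∀ x, r * b x ≤ o x) (hc : 1 ≤ c)
    (hcr : c ≤ r) (hcard : ε * #S ≤ #E) :
    (ε * ((1 - c / r) * o₁) - (1 - ε) * ((c - 1) * o₂)) * #S ≤
      ∑ x ∈ S, o x - c * ∑ x ∈ S, (if x ∈ E then b x else o x) := by
  have hq : 0 ≤ 1 - c / r := sub_nonneg.2 ((div_le_one hr).2 hcr)
  -- An error leaves a gap of at least `(1 - c / r) * o₁`; a correct point gives back at most `(c -
  -- 1) * o₂`.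
  have hterm : ∀ x ∈ S, (if x ∈ E then (1 - c / r) * o₁ + (c - 1) * o₂ else 0) - (c - 1) * o₂ ≤
      o x - c * (if x ∈ E then b x else o x) := by
    intro x _
    split_ifs
    · have h₁ := mul_le_mul_of_nonneg_left (ho x).1 hq
      have h₂ : c * b x ≤ c / r * o x := by
        rw [div_mul_eq_mul_div, le_div_iff₀ hr]
        nlinarith [mul_le_mul_of_nonneg_left (hb x) (zero_le_one.trans hc)]
      linarith
    · nlinarith [mul_le_mul_of_nonneg_left (ho x).2 (sub_nonneg.2 hc)]
  have hsum := sum_le_sum hterm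
  rw [sum_sub_distrib, sum_sub_distrib, sum_const, ← sum_filter, sum_const,
    ← mul_sum, filter_mem_eq_inter, inter_eq_right.2 hE, nsmul_eq_mul, nsmul_eq_mul] at hsum
  have hpos : 0 ≤ (1 - c / r) * o₁ + (c - 1) * o₂ :=
    add_nonneg (mul_nonneg hq ho₁) (mul_nonneg (sub_nonneg.2 hc) (ho₁.trans hoo))
  nlinarith [mul_le_mul_of_nonneg_right hcard hpos]

theorem mainTheorem3 {U : Type*} [DecidableEq U] (B : MaxProblem U) (hB : B.IsAdditive)
    (P : U → ℝ) (G₁ G₂ : Set.Icc (0 : ℚ) (1 / 2) → Finset U) (m : Set.Icc (0 : ℚ) (1 / 2) → U)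
    (o₁ b₁ o₂ b₂ : ℝ) (s : ℕ) (hG : IsGadgetFamily B P G₁ G₂ m o₁ b₁ o₂ b₂ s)
    (hb₁ : 0 < b₁) (hb₂ : 0 < b₂)
    (r : ℝ) (hr : r = min (o₁ / b₁) (o₂ / b₂))
    (ε : ℝ) (hε : ε ∈ Set.Ioo (0 : ℝ) (1 / 2))
    (ALG : FixedPriorityAlgorithm U) (hP : ALG.priority = P)
    (hadvice : ALG.ReadsFewerThan B (fun n => (1 - entropyTwo ε) * n / (2 * s))) :
    ((1 + ε * (r - 1) * o₁ / (ε * o₁ + (1 - ε) * r * o₂) : ℝ) : EReal)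
      ≤ ALG.approximationRatio B := by
  obtain ⟨hbo₁, hbo₂⟩ := hG.bad_lt_opt
  have ho₁ : 0 < o₁ := hb₁.trans hbo₁
  have ho₂ : 0 < o₂ := hb₂.trans hbo₂
  have hr₁ : r * b₁ ≤ o₁ := (le_div_iff₀ hb₁).1 (hr ▸ min_le_left _ _)
  have hr₂ : r * b₂ ≤ o₂ := (le_div_iff₀ hb₂).1 (hr ▸ min_le_right _ _)
  have hr_gt : 1 < r := by
    rw [hr]
    exact lt_min ((one_lt_div hb₁).2 hbo₁) ((one_lt_div hb₂).2 hbo₂)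
  have hr_pos : 0 < r := zero_lt_one.trans hr_gt
  have hε₀ := hε.1
  have hε₁ : 0 < 1 - ε := by linarith [hε.2]
  refine le_sInf ?_
  rintro _ ⟨c, ⟨hc, α, hα⟩, rfl⟩
  rw [EReal.coe_le_coe_iff]
  by_contra! hlt
  have hεo : 0 < ε * o₁ := mul_pos hε₀ ho₁
  have hro : 0 < (1 - ε) * r * o₂ := mul_pos (mul_pos hε₁ hr_pos) ho₂
  have hden : (c - 1) * (ε * o₁ + (1 - ε) * r * o₂) < ε * (r - 1) * o₁ := by
    rw [← lt_div_iff₀ (by positivity)]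
    linarith
  have hcr : c ≤ r := by
    by_contra! h
    nlinarith [mul_pos (sub_pos.2 h) hεo, mul_nonneg (sub_nonneg.2 hc) hro.le]
  -- The guaranteed gap per point of `S`; it is positive because `c` is below the claimed ratio.
  obtain ⟨δ, hδ⟩ : ∃ δ, δ = ε * ((1 - c / r) * o₁) - (1 - ε) * ((c - 1) * o₂) := ⟨_, rfl⟩
  have hδ_pos : 0 < δ := by
    have : δ = (ε * (r - 1) * o₁ - (c - 1) * (ε * o₁ + (1 - ε) * r * o₂)) / r := by
      rw [hδ]
      field_simp
      ring
    rw [this]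
    exact div_pos (sub_pos.2 hden) hr_pos
  obtain ⟨N, hN⟩ := Filter.eventually_atTop.1 hadvice
  have : Infinite (Set.Icc (0 : ℚ) (1 / 2)) := (Set.Icc_infinite (by norm_num)).to_subtype
  -- `N` makes the asymptotic advice bound apply, and `⌊α / δ⌋₊ + 1` makes the total gap `δ * #S`
  -- exceed `α`.
  obtain ⟨S, hS⟩ := Infinite.exists_subset_card_eq (Set.Icc (0 : ℚ) (1 / 2))
    (N + ⌊α / δ⌋₊ + 1)
  have hSne : S.Nonempty := card_pos.1 (by omega)
  have hSα : α < δ * #S := by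
    rw [← div_lt_iff₀' hδ_pos]
    refine (Nat.lt_floor_add_one _).trans_le ?_
    rw [hS]
    push_cast
    linarith [Nat.cast_nonneg (α := ℝ) N]
  choose d hd using hG.distinguishing
  obtain ⟨T, -, hT⟩ := hG.exists_many_errors hε hP d hSne
    fun n hn => hN n (by omega)
  have hrun : ALG.run (S.biUnion (gadgetChoice G₁ G₂ T))
      (ALG.oracle (S.biUnion (gadgetChoice G₁ G₂ T))) ⊆ S.biUnion (gadgetChoice G₁ G₂ T) :=
    filter_subset _ _
  have hopt := hB.opt_biUnion (fun _ h => hG.isInstance_biUnion_gadgetChoice T h)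
    (hG.pairwise_disjoint_gadgetChoice T) (hG.opt_gadgetChoice T) hSne
  obtain ⟨v, hv, hle⟩ := hα _ (hG.isInstance_biUnion_gadgetChoice T hSne) _ hopt
  have hval := hG.value_biUnion_gadgetChoice_le hB hd hSne T hrun
  rw [hv, WithBot.coe_le_coe] at hval
  have hloss := mul_card_le_sum_sub_mul_sum (errorSet_subset m d S T _)
    (o := fun x => if x ∈ T then o₂ else o₁) (b := fun x => if x ∈ T then b₂ else b₁)
    ho₁.le hG.opt_le
    (fun x => by split_ifs <;> simp [hG.opt_le]) hr_pos
    (fun x => by split_ifs <;> assumption) hc hcr hT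
  rw [← hδ] at hloss
  have := mul_le_mul_of_nonneg_left hval (zero_le_one.trans hc)
  linarith
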